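/- For $\alpha,\beta\in\mathbb C$ with $\operatorname{Re}\alpha>0$, let $U(\alpha;\beta;z)$ be the confluent hypergeometric function of the second kind, defined for $\operatorname{Re} z>0$ by $$U(\alpha;\beta;z)=\frac1{\Gamma(\alpha)}\int_0^\infty e^{-zt}\,t^{\alpha-1}(1+t)^{\beta-\alpha-1}\,dt$$ and continued holomorphically to $z\in\mathbb C\setminus\mathbb R_{\le 0}$ by moving the contour $(0,\infty)$ to a ray $\{te^{i\theta}:t>0\}$ with $|\theta|<\pi/2$ and $\operatorname{Re}(ze^{i\theta})>0$. For every integer $n\ge 2$ and every real $x>0$, the integral $$\mathcal I_n(x)=\frac1{2\pi i}\int_{\frac32-i\infty}^{\frac32+i\infty}(2\pi x)^{-s}\,\Gamma(s)\,\Gamma(s+1)\,\Gamma(n-s)\cos\left(\frac{\pi s}{2}\right)ds$$ converges absolutely, and $$\mathcal I_n(x)=(n-1)!\,n!\,\operatorname{Re}\bigl(U(n;0;2\pi i x)\bigr).$$ -/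

import Mathlib

open MeasureTheory

noncomputable section

namespace CotangentSum

/-- The integrand `(2πx)^{-s} Γ(s) Γ(s+1) Γ(n-s) cos(πs/2)`. The base `2πx` is a positive real
when `x > 0`, so the power is `exp(-s log(2πx))` with the real logarithm. -/
def barnesIntegrand (n : ℕ) (x : ℝ) (s : ℂ) : ℂ :=
  ((2 * Real.pi * x : ℝ) : ℂ) ^ (-s) * Complex.Gamma s * Complex.Gamma (s + 1) *
    Complex.Gamma (n - s) * Complex.cos (Real.pi * s / 2)

/-- The line integral `(1/2πi) ∫_{(3/2)} (2πx)^{-s} Γ(s) Γ(s+1) Γ(n-s) cos(πs/2) ds` over the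
upward vertical line `s = 3/2 + it`, `ds = i dt`. -/
def barnesIntegral (n : ℕ) (x : ℝ) : ℂ :=
  1 / (2 * Real.pi * Complex.I) *
    ∫ t : ℝ, barnesIntegrand n x (((3 / 2 : ℝ) : ℂ) + t * Complex.I) * Complex.I

/-- The contour integral `(1/Γ(α)) ∫ e^{-zw} w^{α-1} (1+w)^{β-α-1} dw` over the ray
`w = t e^{iθ}`, `0 < t < ∞`, `dw = e^{iθ} dt`. For `|θ| < π/2` both `w` and `1 + w` lie in the
right half-plane, where the powers are the principal ones. -/
def hyperURay (θ : ℝ) (α β z : ℂ) : ℂ :=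
  1 / Complex.Gamma α *
    ∫ t in Set.Ioi (0 : ℝ),
      Complex.exp (-z * (t * Complex.exp (θ * Complex.I))) *
        (t * Complex.exp (θ * Complex.I)) ^ (α - 1) *
        (1 + t * Complex.exp (θ * Complex.I)) ^ (β - α - 1) * Complex.exp (θ * Complex.I)

open scoped Classical in
/-- The confluent hypergeometric function of the second kind `U(α; β; z)`, for `Re α > 0` and `z` in
the plane cut along the nonpositive reals. On `Re z > 0` the contour is `(0, ∞)`. The holomorphic
continuation to the cut plane is obtained by moving the contour to the ray of argument `-arg(z)/2`;
this lies in `(-π/2, π/2)`, and on that ray `arg(zw) = arg(z)/2` also lies in `(-π/2, π/2)`, so that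
`e^{-zw}` decays exponentially. -/
def hyperU (α β z : ℂ) : ℂ :=
  if 0 < z.re then hyperURay 0 α β z else hyperURay (-(Complex.arg z) / 2) α β z

/-- On the right half-plane, `hyperU` is the classical integral. -/
theorem hyperU_of_re_pos {α β z : ℂ} (hz : 0 < z.re) :
    hyperU α β z = 1 / Complex.Gamma α *
      ∫ t in Set.Ioi (0 : ℝ),
        Complex.exp (-z * t) * (t : ℂ) ^ (α - 1) * (1 + (t : ℂ)) ^ (β - α - 1) := by
  simp [hyperU, hyperURay, hz]

end CotangentSum

end

/-!
The identity is Parseval's formula for the Mellin transform. With `c = e^{-iπ/4}` and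
`a = 2πx e^{iπ/4}`, the contour of `U(n; 0; 2πix)` is the ray `w = ct`, and there `2πix · w = at`, so
`U(n; 0; 2πix)` is a constant times `∫ t^{n-1} e^{-at} (1 + ct)^{-n-1} dt`. The Mellin transforms of
the two factors are `a^{-s} Γ(s)` and `c^{-s} Γ(s) Γ(n+1-s) / Γ(n+1)` (`mellin_exp_neg_mul`,
`mellin_one_add_mul_cpow_neg`). Parseval (`mellin_parseval`) therefore equates the integral with
the integral over the vertical line of `(2πx)^{-s} e^{-πis/2} Γ(s) Γ(s+1) Γ(n-s)`, up to a constant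
(`integral_rotatedIntegrand`).

Reflecting the line in the real axis conjugates `e^{-πis/2}` into `e^{πis/2}` and leaves the other
factors alone, so averaging over the reflection turns the exponential into `cos (πs/2)` and
`U` into its real part.

On the imaginary axis itself `Γ(s) (2πix)^{-s}` is not integrable over the line. The ray of argument
`-π/4` keeps both `a` and `c` in the open right half-plane, where `a^{-s} Γ(s)` decays exponentially
(`norm_Gamma_le`, `verticalIntegrable_mellin_exp_neg_mul`); this is what makes Mellin inversion and
Fubini available.
-/

noncomputable section

open Set Filter Topology

namespace CotangentSum

/-! ### Euler's integral with a complex scaling, and the decay of `Γ` on vertical lines -/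

theorem ofReal_mul_cpow {v : ℝ} (hv : 0 < v) (c w : ℂ) :
    ((v : ℂ) * c) ^ w = (v : ℂ) ^ w * c ^ w := by
  have hv0 : (v : ℂ) ≠ 0 := Complex.ofReal_ne_zero.2 hv.ne'
  rcases eq_or_ne c 0 with rfl | hc
  · rcases eq_or_ne w 0 with rfl | hw <;> simp [*]
  · rw [Complex.cpow_def_of_ne_zero (mul_ne_zero hv0 hc), Complex.cpow_def_of_ne_zero hv0,
      Complex.cpow_def_of_ne_zero hc, Complex.log_ofReal_mul hv hc, ← Complex.ofReal_log hv.le,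
      add_mul, Complex.exp_add]

theorem norm_cpow_mul_exp_neg_mul (s r : ℂ) {t : ℝ} (ht : 0 < t) :
    ‖(t : ℂ) ^ (s - 1) * Complex.exp (-r * t)‖ = t ^ (s.re - 1) * Real.exp (-(r.re * t)) := by
  rw [norm_mul, Complex.norm_cpow_eq_rpow_re_of_pos ht, Complex.norm_exp]
  simp

theorem integrableOn_rpow_mul_exp_neg_mul {σ b : ℝ} (hσ : 0 < σ) (hb : 0 < b) :
    IntegrableOn (fun t : ℝ => t ^ (σ - 1) * Real.exp (-(b * t))) (Ioi 0) := by
  have h := integrableOn_rpow_mul_exp_neg_mul_rpow (p := 1) (s := σ - 1) (b := b)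
    (by linarith) one_pos hb
  simpa using h

theorem measurable_cpow_mul_exp_neg_mul (s r : ℂ) :
    Measurable (fun t : ℝ => (t : ℂ) ^ (s - 1) * Complex.exp (-r * t)) := by
  fun_prop

theorem integrableOn_cpow_mul_exp_neg_mul {s r : ℂ} (hs : 0 < s.re) (hr : 0 < r.re) :
    IntegrableOn (fun t : ℝ => (t : ℂ) ^ (s - 1) * Complex.exp (-r * t)) (Ioi 0) := by
  refine (integrableOn_rpow_mul_exp_neg_mul hs hr).mono'
    (measurable_cpow_mul_exp_neg_mul s r).aestronglyMeasurable ?_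
  filter_upwards [ae_restrict_mem measurableSet_Ioi] with t ht
  rw [norm_cpow_mul_exp_neg_mul s r ht]

theorem integral_norm_cpow_mul_exp_neg_mul {s r : ℂ} (hs : 0 < s.re) (hr : 0 < r.re) :
    ∫ t in Ioi (0 : ℝ), ‖(t : ℂ) ^ (s - 1) * Complex.exp (-r * t)‖ =
      r.re ^ (-s.re) * Real.Gamma s.re := by
  rw [setIntegral_congr_fun measurableSet_Ioi
    (fun t ht => norm_cpow_mul_exp_neg_mul s r (mem_Ioi.1 ht)),
    Real.integral_rpow_mul_exp_neg_mul_Ioi hs hr, one_div, Real.inv_rpow hr.le,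
    Real.rpow_neg hr.le]

theorem differentiableAt_integral_cpow_mul_exp_neg_mul {s r : ℂ} (hs : 0 < s.re)
    (hr : 0 < r.re) :
    DifferentiableAt ℂ
      (fun r : ℂ => ∫ t in Ioi (0 : ℝ), (t : ℂ) ^ (s - 1) * Complex.exp (-r * t)) r := by
  have hball : ∀ w ∈ Metric.ball r (r.re / 2), r.re / 2 < w.re := by
    intro w hw
    have h1 : |(w - r).re| < r.re / 2 :=
      (Complex.abs_re_le_norm _).trans_lt (by simpa [dist_eq_norm] using hw)
    rw [Complex.sub_re] at h1
    linarith [(abs_lt.1 h1).1]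
  refine (hasDerivAt_integral_of_dominated_loc_of_deriv_le
    (F' := fun w t => (t : ℂ) ^ (s - 1) * (Complex.exp (-w * t) * (-t)))
    (bound := fun t => t ^ (s.re + 1 - 1) * Real.exp (-(r.re / 2 * t)))
    (Metric.ball_mem_nhds r (half_pos hr)) (Eventually.of_forall fun w =>
      (measurable_cpow_mul_exp_neg_mul s w).aestronglyMeasurable)
    (integrableOn_cpow_mul_exp_neg_mul hs hr)
    (by fun_prop) ?_ (integrableOn_rpow_mul_exp_neg_mul (by linarith) (half_pos hr))
    ?_).2.differentiableAt
  · filter_upwards [ae_restrict_mem measurableSet_Ioi] with t ht w hw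
    have ht : 0 < t := ht
    rw [← mul_assoc, norm_mul, norm_cpow_mul_exp_neg_mul s w ht, norm_neg, Complex.norm_real,
      Real.norm_of_nonneg ht.le, add_sub_right_comm, Real.rpow_add_one ht.ne', mul_right_comm]
    have := (hball w hw).le
    gcongr
  · refine Eventually.of_forall fun t w _ => ?_
    have h : HasDerivAt (fun w : ℂ => -w * t) (-t) w := by
      simpa using (hasDerivAt_id w).neg.mul_const (t : ℂ)
    exact h.cexp.const_mul _

/-- Euler's integral for `Γ` with a complex scaling of the exponential: both sides are holomorphic
in `r` on the right half-plane and agree on the positive reals. -/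
theorem integral_cpow_mul_exp_neg_mul {s r : ℂ} (hs : 0 < s.re) (hr : 0 < r.re) :
    ∫ t in Ioi (0 : ℝ), (t : ℂ) ^ (s - 1) * Complex.exp (-r * t) =
      r ^ (-s) * Complex.Gamma s := by
  have hopen : IsOpen {r : ℂ | 0 < r.re} := isOpen_lt continuous_const Complex.continuous_re
  have hf : AnalyticOnNhd ℂ
      (fun r : ℂ => ∫ t in Ioi (0 : ℝ), (t : ℂ) ^ (s - 1) * Complex.exp (-r * t))
      {r : ℂ | 0 < r.re} :=
    DifferentiableOn.analyticOnNhd (fun r hr =>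
      (differentiableAt_integral_cpow_mul_exp_neg_mul hs hr).differentiableWithinAt) hopen
  have hg : AnalyticOnNhd ℂ (fun r : ℂ => r ^ (-s) * Complex.Gamma s) {r : ℂ | 0 < r.re} :=
    DifferentiableOn.analyticOnNhd (fun r hr =>
      ((differentiableAt_id.cpow_const (Or.inl hr)).mul_const _).differentiableWithinAt) hopen
  -- The identity theorem needs agreement along `1 + 1 / (n + 1) → 1` only.
  refine hf.eqOn_of_preconnected_of_frequently_eq hg (convex_halfSpace_re_gt 0).isPreconnected
    (z₀ := 1) (by simp) ?_ hr
  have hlim : Tendsto (fun n : ℕ => (1 : ℂ) + ((1 / ((n : ℝ) + 1) : ℝ) : ℂ)) atTop (𝓝[≠] 1) := by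
    refine tendsto_nhdsWithin_iff.2 ⟨?_, Eventually.of_forall fun n => ?_⟩
    · have h := (Complex.continuous_ofReal.tendsto 0).comp
        (tendsto_one_div_add_atTop_nhds_zero_nat (𝕜 := ℝ))
      simpa only [Function.comp_apply, Complex.ofReal_zero, add_zero] using h.const_add 1
    · simp only [mem_compl_iff, mem_singleton_iff, add_eq_left, Complex.ofReal_eq_zero]
      positivity
  refine hlim.frequently (Eventually.of_forall fun n => ?_).frequently
  have hpos : 0 < 1 + 1 / ((n : ℝ) + 1) := by positivity
  have h := Complex.integral_cpow_mul_exp_neg_mul_Ioi hs hpos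
  rw [← Complex.ofReal_one, ← Complex.ofReal_add]
  rw [one_div (Complex.ofReal _), Complex.inv_cpow _ _ (by
    rw [Complex.arg_ofReal_of_nonneg hpos.le]; exact Real.pi_pos.ne), ← Complex.cpow_neg] at h
  rw [← h]
  simp only [neg_mul, Complex.ofReal_one]

/-- Exponential decay of `Γ` on vertical lines, at every rate `φ < π / 2`: compare Euler's integral
along the ray of argument `±φ` with the integral of its absolute value. -/
theorem norm_Gamma_le {s : ℂ} (hs : 0 < s.re) {φ : ℝ} (hφ : 0 ≤ φ) (hφ' : φ < Real.pi / 2) :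
    ‖Complex.Gamma s‖ ≤
      Real.cos φ ^ (-s.re) * Real.Gamma s.re * Real.exp (-(φ * |s.im|)) := by
  have key : ∀ ψ : ℝ, |ψ| < Real.pi / 2 →
      Real.exp (ψ * s.im) * ‖Complex.Gamma s‖ ≤ Real.cos ψ ^ (-s.re) * Real.Gamma s.re := by
    intro ψ hψ
    obtain ⟨h1, h2⟩ := abs_lt.1 hψ
    have hre : (Complex.exp (ψ * Complex.I)).re = Real.cos ψ := Complex.exp_ofReal_mul_I_re ψ
    have hr : 0 < (Complex.exp (ψ * Complex.I)).re := by
      rw [hre]; exact Real.cos_pos_of_mem_Ioo ⟨h1, h2⟩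
    have hpow : ‖Complex.exp (ψ * Complex.I) ^ (-s)‖ = Real.exp (ψ * s.im) := by
      rw [Complex.norm_cpow_of_ne_zero (Complex.exp_ne_zero _), Complex.norm_exp_ofReal_mul_I,
        Complex.arg_exp_mul_I, toIocMod_eq_self _ |>.2 ⟨by linarith, by linarith⟩]
      simp [Real.exp_neg]
    have h := norm_integral_le_integral_norm (μ := volume.restrict (Ioi (0 : ℝ)))
      (fun t : ℝ => (t : ℂ) ^ (s - 1) * Complex.exp (-Complex.exp (ψ * Complex.I) * t))
    rwa [integral_cpow_mul_exp_neg_mul hs hr, integral_norm_cpow_mul_exp_neg_mul hs hr, norm_mul,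
      hpow, hre] at h
  rw [Real.exp_neg, ← div_eq_mul_inv, le_div_iff₀ (Real.exp_pos _), mul_comm]
  rcases le_total 0 s.im with h | h
  · rw [abs_of_nonneg h]
    exact key φ (by rwa [abs_of_nonneg hφ])
  · rw [abs_of_nonpos h, mul_neg, ← neg_mul, ← Real.cos_neg]
    exact key (-φ) (by rwa [abs_neg, abs_of_nonneg hφ])

theorem mellinConvergent_exp_neg_mul {s r : ℂ} (hs : 0 < s.re) (hr : 0 < r.re) :
    MellinConvergent (fun t : ℝ => Complex.exp (-r * t)) s :=
  integrableOn_cpow_mul_exp_neg_mul hs hr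

theorem mellin_exp_neg_mul {s r : ℂ} (hs : 0 < s.re) (hr : 0 < r.re) :
    mellin (fun t : ℝ => Complex.exp (-r * t)) s = r ^ (-s) * Complex.Gamma s :=
  integral_cpow_mul_exp_neg_mul hs hr

/-! ### Parseval's formula for the Mellin transform -/

/-- Parseval's formula for the Mellin transform, by Fubini and Mellin inversion of `f`. The same
use of Fubini shows that the product of the transforms is integrable. -/
theorem mellin_parseval {f g : ℝ → ℂ} {σ : ℝ} {ν : ℂ}
    (hf : MellinConvergent f σ) (hF : Complex.VerticalIntegrable (mellin f) σ)
    (hfc : Continuous f) (hg : MellinConvergent g (ν - σ)) :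
    Complex.VerticalIntegrable (fun s => mellin f s * mellin g (ν - s)) σ ∧
      ∫ y : ℝ, mellin f (σ + y * Complex.I) * mellin g (ν - (σ + y * Complex.I)) =
        2 * Real.pi * ∫ t in Ioi (0 : ℝ), (t : ℂ) ^ (ν - 1) * (f t * g t) := by
  have hsplit : ∀ t : ℝ, 0 < t → ∀ u v : ℂ, (t : ℂ) ^ (u + v) = (t : ℂ) ^ u * (t : ℂ) ^ v :=
    fun t ht u v => Complex.cpow_add _ _ (Complex.ofReal_ne_zero.2 ht.ne')
  have hint : Integrable (Function.uncurry fun (y t : ℝ) =>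
      (t : ℂ) ^ (-(y * Complex.I)) *
        (mellin f (σ + y * Complex.I) * ((t : ℂ) ^ (ν - σ - 1) • g t)))
      (volume.prod (volume.restrict (Ioi 0))) := by
    refine (Integrable.mul_prod (μ := volume) (ν := volume.restrict (Ioi (0 : ℝ))) hF hg).bdd_mul
      (c := 1) (f := fun z : ℝ × ℝ => (z.2 : ℂ) ^ (-(z.1 * Complex.I))) ?_ ?_
    · exact Measurable.aestronglyMeasurable (by fun_prop)
    · have : ∀ᵐ z ∂(volume.prod (volume.restrict (Ioi (0 : ℝ)))), (z : ℝ × ℝ).2 ∈ Ioi (0 : ℝ) :=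
        Measure.quasiMeasurePreserving_snd.ae (ae_restrict_mem measurableSet_Ioi)
      filter_upwards [this] with z hz
      rw [Complex.norm_cpow_eq_rpow_re_of_pos hz]
      simp
  have hinv : ∀ t : ℝ, 0 < t → ∫ y : ℝ, (t : ℂ) ^ (-(y * Complex.I)) *
        (mellin f (σ + y * Complex.I) * ((t : ℂ) ^ (ν - σ - 1) • g t)) =
      2 * Real.pi * ((t : ℂ) ^ (ν - 1) * (f t * g t)) := by
    intro t ht
    have h := mellinInv_mellin_eq σ f ht hf hF hfc.continuousAt
    have hpi : (Real.pi : ℂ) ≠ 0 := Complex.ofReal_ne_zero.2 Real.pi_ne_zero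
    rw [← h, mellinInv, Complex.real_smul]
    push_cast
    rw [show ∀ A B C : ℂ, 2 * (Real.pi : ℂ) * (A * (1 / (2 * Real.pi) * B * C)) = A * C * B by
      intro A B C; field_simp, ← integral_const_mul]
    congr 1 with y
    simp only [smul_eq_mul]
    rw [show ν - σ - 1 = (ν - 1) + (-σ) by ring, hsplit t ht, neg_add, hsplit t ht]
    ring
  have hFG : ∀ y : ℝ, ∫ t in Ioi (0 : ℝ), (t : ℂ) ^ (-(y * Complex.I)) *
        (mellin f (σ + y * Complex.I) * ((t : ℂ) ^ (ν - σ - 1) • g t)) =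
      mellin f (σ + y * Complex.I) * mellin g (ν - (σ + y * Complex.I)) := by
    intro y
    rw [mellin.eq_def g, ← integral_const_mul]
    refine setIntegral_congr_fun measurableSet_Ioi fun t ht => ?_
    simp only [smul_eq_mul]
    rw [show ν - (σ + y * Complex.I) - 1 = -(y * Complex.I) + (ν - σ - 1) by ring,
      hsplit t ht]
    ring
  refine ⟨hint.integral_prod_left.congr (Eventually.of_forall hFG), ?_⟩
  calc _ = ∫ y : ℝ, ∫ t in Ioi (0 : ℝ), (t : ℂ) ^ (-(y * Complex.I)) *
        (mellin f (σ + y * Complex.I) * ((t : ℂ) ^ (ν - σ - 1) • g t)) := by simp_rw [hFG]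
    _ = ∫ t in Ioi (0 : ℝ), ∫ y : ℝ, (t : ℂ) ^ (-(y * Complex.I)) *
        (mellin f (σ + y * Complex.I) * ((t : ℂ) ^ (ν - σ - 1) • g t)) :=
        integral_integral_swap hint
    _ = _ := by
        rw [setIntegral_congr_fun measurableSet_Ioi fun t ht => hinv t ht, integral_const_mul]

/-! ### The beta integral with a complex scaling -/

/-- The kernel whose two iterated integrals give the Mellin transform of `(1 + c t)^{-b}`. -/
theorem integrable_beta_kernel {b c s : ℂ} (hc : 0 < c.re) (hs : 0 < s.re) (hsb : s.re < b.re) :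
    Integrable (Function.uncurry fun v t : ℝ =>
      (v : ℂ) ^ (b - 1) * Complex.exp (-v) * ((t : ℂ) ^ (s - 1) * Complex.exp (-(v * c) * t)))
      ((volume.restrict (Ioi 0)).prod (volume.restrict (Ioi 0))) := by
  have hvc : ∀ v : ℝ, 0 < v → 0 < ((v : ℂ) * c).re := fun v hv => by
    rw [Complex.re_ofReal_mul]; positivity
  refine (integrable_prod_iff (Measurable.aestronglyMeasurable ?_)).2 ⟨?_, ?_⟩
  · unfold Function.uncurry; fun_prop
  · filter_upwards [ae_restrict_mem measurableSet_Ioi] with v hv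
    exact (integrableOn_cpow_mul_exp_neg_mul hs (hvc v hv)).const_mul
      ((v : ℂ) ^ (b - 1) * Complex.exp (-v))
  · have h := (integrableOn_rpow_mul_exp_neg_mul (sub_pos.2 hsb) one_pos).mul_const
      (c.re ^ (-s.re) * Real.Gamma s.re)
    refine h.congr ?_
    filter_upwards [ae_restrict_mem measurableSet_Ioi] with v hv
    have hv : 0 < v := hv
    simp only [Function.uncurry_apply_pair]
    simp_rw [norm_mul ((v : ℂ) ^ (b - 1) * Complex.exp (-v))]
    rw [integral_const_mul, integral_norm_cpow_mul_exp_neg_mul hs (hvc v hv), norm_mul,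
      Complex.norm_cpow_eq_rpow_re_of_pos hv, Complex.norm_exp, Complex.re_ofReal_mul,
      Real.mul_rpow hv.le hc.le, show b.re - s.re - 1 = (b - 1).re + (-s.re) by simp; ring,
      Real.rpow_add hv]
    simp
    ring

theorem integral_beta_kernel_left {b c : ℂ} (hc : 0 < c.re) (hb : 0 < b.re) (s : ℂ) {t : ℝ}
    (ht : 0 < t) :
    ∫ v in Ioi (0 : ℝ),
        (v : ℂ) ^ (b - 1) * Complex.exp (-v) * ((t : ℂ) ^ (s - 1) * Complex.exp (-(v * c) * t)) =
      Complex.Gamma b * ((t : ℂ) ^ (s - 1) • (1 + c * t) ^ (-b)) := by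
  have hr : 0 < (1 + c * t).re := by
    rw [Complex.add_re, mul_comm, Complex.re_ofReal_mul, Complex.one_re]; positivity
  rw [smul_eq_mul, show Complex.Gamma b * ((t : ℂ) ^ (s - 1) * (1 + c * t) ^ (-b)) =
      (t : ℂ) ^ (s - 1) * ((1 + c * t) ^ (-b) * Complex.Gamma b) by ring,
    ← integral_cpow_mul_exp_neg_mul hb hr, ← integral_const_mul]
  congr 1 with v
  rw [show -(1 + c * (t : ℂ)) * v = -v + -(v * c) * t by ring, Complex.exp_add]
  ring

theorem mellinConvergent_one_add_mul_cpow_neg {b c s : ℂ} (hc : 0 < c.re) (hs : 0 < s.re)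
    (hsb : s.re < b.re) : MellinConvergent (fun t : ℝ => (1 + c * t) ^ (-b)) s := by
  have hb : 0 < b.re := hs.trans hsb
  have h := (integrable_beta_kernel hc hs hsb).integral_prod_right.const_mul (Complex.Gamma b)⁻¹
  refine h.congr ?_
  filter_upwards [ae_restrict_mem measurableSet_Ioi] with t ht
  simp only [Function.uncurry_apply_pair]
  rw [integral_beta_kernel_left hc hb s ht,
    inv_mul_cancel_left₀ (Complex.Gamma_ne_zero_of_re_pos hb)]

/-- Euler's beta integral over `(0, ∞)` with a complex scaling `c`. -/
theorem mellin_one_add_mul_cpow_neg {b c s : ℂ} (hc : 0 < c.re) (hs : 0 < s.re)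
    (hsb : s.re < b.re) :
    mellin (fun t : ℝ => (1 + c * t) ^ (-b)) s =
      c ^ (-s) * Complex.Gamma s * Complex.Gamma (b - s) / Complex.Gamma b := by
  have hb : 0 < b.re := hs.trans hsb
  rw [eq_div_iff (Complex.Gamma_ne_zero_of_re_pos hb), mul_comm, mellin, ← integral_const_mul,
    ← setIntegral_congr_fun measurableSet_Ioi
      fun t ht => integral_beta_kernel_left hc hb s (mem_Ioi.1 ht),
    ← integral_integral_swap (integrable_beta_kernel hc hs hsb)]
  have hinner : ∀ v ∈ Ioi (0 : ℝ), ∫ t in Ioi (0 : ℝ),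
        (v : ℂ) ^ (b - 1) * Complex.exp (-v) * ((t : ℂ) ^ (s - 1) * Complex.exp (-(v * c) * t)) =
      c ^ (-s) * Complex.Gamma s * ((v : ℂ) ^ (b - s - 1) * Complex.exp (-1 * v)) := by
    intro v hv
    have hv : 0 < v := hv
    have hv0 : (v : ℂ) ≠ 0 := Complex.ofReal_ne_zero.2 hv.ne'
    rw [integral_const_mul, integral_cpow_mul_exp_neg_mul hs
      (by rw [Complex.re_ofReal_mul]; positivity), ofReal_mul_cpow hv,
      show b - s - 1 = (b - 1) + (-s) by ring, Complex.cpow_add _ _ hv0, neg_one_mul]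
    ring
  rw [setIntegral_congr_fun measurableSet_Ioi hinner, integral_const_mul,
    integral_cpow_mul_exp_neg_mul (by simpa using hsb) (by simp), Complex.one_cpow, one_mul]

theorem exp_ofReal_mul_I_cpow {φ : ℝ} (h1 : -Real.pi < φ) (h2 : φ < Real.pi) (w : ℂ) :
    Complex.exp (φ * Complex.I) ^ w = Complex.exp (φ * Complex.I * w) := by
  rw [Complex.cpow_def_of_ne_zero (Complex.exp_ne_zero _), Complex.log_exp]
  · simpa using h1
  · simpa using h2.le

theorem integrable_exp_neg_mul_abs {b : ℝ} (hb : 0 < b) :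
    Integrable (fun y : ℝ => Real.exp (-(b * |y|))) := by
  rw [← integrableOn_univ, ← Iic_union_Ioi (a := (0 : ℝ)), integrableOn_union]
  constructor
  · refine (integrableOn_exp_mul_Iic hb 0).congr_fun (fun y hy => ?_) measurableSet_Iic
    simp only [abs_of_nonpos (mem_Iic.1 hy), mul_neg, neg_neg]
  · refine (integrableOn_exp_mul_Ioi (neg_lt_zero.2 hb) 0).congr_fun (fun y hy => ?_)
      measurableSet_Ioi
    simp only [abs_of_pos (mem_Ioi.1 hy), neg_mul]

/-- `|r^{-s}|` grows at rate `|arg r| < π / 2` and `Γ` decays at every rate below `π / 2`. -/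
theorem verticalIntegrable_mellin_exp_neg_mul {σ : ℝ} {r : ℂ} (hσ : 0 < σ) (hr : 0 < r.re) :
    Complex.VerticalIntegrable (mellin fun t : ℝ => Complex.exp (-r * t)) σ := by
  have hr0 : r ≠ 0 := by rintro rfl; simp at hr
  obtain ⟨φ, hφ1, hφ2⟩ := exists_between (Complex.abs_arg_lt_pi_div_two_iff.2 (Or.inl hr))
  have hre : ∀ y : ℝ, ((σ : ℂ) + y * Complex.I).re = σ := fun y => by simp
  have hformula : ∀ y : ℝ, mellin (fun t : ℝ => Complex.exp (-r * t)) (σ + y * Complex.I) =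
      r ^ (-((σ : ℂ) + y * Complex.I)) * Complex.Gamma (σ + y * Complex.I) := fun y =>
    mellin_exp_neg_mul (by rwa [hre]) hr
  unfold Complex.VerticalIntegrable
  simp_rw [hformula]
  have hcont : Continuous fun y : ℝ =>
      r ^ (-((σ : ℂ) + y * Complex.I)) * Complex.Gamma (σ + y * Complex.I) := by
    refine continuous_iff_continuousAt.2 fun y => ContinuousAt.mul ?_ ?_
    · exact ContinuousAt.const_cpow (by fun_prop) (Or.inl hr0)
    · refine ContinuousAt.comp (g := Complex.Gamma) (f := fun y : ℝ => (σ : ℂ) + y * Complex.I)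
        (Complex.differentiableAt_Gamma _ fun m hm => ?_).continuousAt (by fun_prop)
      have := congrArg Complex.re hm
      rw [hre, Complex.neg_re, Complex.natCast_re] at this
      linarith [m.cast_nonneg (α := ℝ)]
  refine ((integrable_exp_neg_mul_abs (sub_pos.2 hφ1)).const_mul
    (‖r‖ ^ (-σ) * (Real.cos φ ^ (-σ) * Real.Gamma σ))).mono' hcont.aestronglyMeasurable
    (Eventually.of_forall fun y => ?_)
  have hG := norm_Gamma_le (s := σ + y * Complex.I) (by rwa [hre])
    ((abs_nonneg _).trans hφ1.le) hφ2
  rw [hre, show ((σ : ℂ) + y * Complex.I).im = y by simp] at hG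
  have hP : ‖r ^ (-((σ : ℂ) + y * Complex.I))‖ ≤ ‖r‖ ^ (-σ) * Real.exp (|r.arg| * |y|) := by
    rw [Complex.norm_cpow_of_ne_zero hr0, div_eq_mul_inv, ← Real.exp_neg, ← abs_mul]
    simp only [Complex.neg_re, Complex.neg_im, hre, mul_neg, neg_neg]
    gcongr
    simpa [mul_comm] using le_abs_self (r.arg * y)
  calc _ ≤ ‖r‖ ^ (-σ) * Real.exp (|r.arg| * |y|) *
        (Real.cos φ ^ (-σ) * Real.Gamma σ * Real.exp (-(φ * |y|))) := by
        rw [norm_mul]; gcongr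
    _ = _ := by
        rw [show -((φ - |r.arg|) * |y|) = |r.arg| * |y| + -(φ * |y|) by ring, Real.exp_add]
        ring

/-! ### The Barnes integral of `U(n; 0; 2πix)` -/

/-- The Barnes integrand for `U(n; 0; 2πix)`: the cosine in `barnesIntegrand` is replaced by
`e^{-πis/2}`, so that together with `(2πx)^{-s}` it makes up `(2πix)^{-s}`. -/
def rotatedIntegrand (n : ℕ) (x : ℝ) (s : ℂ) : ℂ :=
  ((2 * Real.pi * x : ℝ) : ℂ) ^ (-s) * Complex.exp (-(Real.pi * s / 2 * Complex.I)) *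
    (Complex.Gamma s * Complex.Gamma (s + 1) * Complex.Gamma (n - s))

/-- Conjugating `rotatedIntegrand` together with its argument changes only the sign in
`e^{-πis/2}`. -/
theorem barnesIntegrand_eq {x : ℝ} (hx : 0 < x) (n : ℕ) (s : ℂ) :
    barnesIntegrand n x s = (rotatedIntegrand n x s +
      starRingEnd ℂ (rotatedIntegrand n x (starRingEnd ℂ s))) / 2 := by
  have hX : (0 : ℝ) < 2 * Real.pi * x := by positivity
  have hX0 : ((2 * Real.pi * x : ℝ) : ℂ) ≠ 0 := Complex.ofReal_ne_zero.2 hX.ne'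
  have h : starRingEnd ℂ (rotatedIntegrand n x (starRingEnd ℂ s)) =
      ((2 * Real.pi * x : ℝ) : ℂ) ^ (-s) * Complex.exp (Real.pi * s / 2 * Complex.I) *
        (Complex.Gamma s * Complex.Gamma (s + 1) * Complex.Gamma (n - s)) := by
    unfold rotatedIntegrand
    rw [Complex.cpow_def_of_ne_zero hX0, Complex.cpow_def_of_ne_zero hX0,
      ← Complex.ofReal_log hX.le]
    simp only [map_mul, ← Complex.exp_conj, ← Complex.Gamma_conj, map_neg, map_add, map_sub,
      map_div₀, map_one, map_natCast, Complex.conj_conj, Complex.conj_ofReal, Complex.conj_I,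
      map_ofNat, mul_neg, neg_neg]
  rw [h, barnesIntegrand, rotatedIntegrand, Complex.cos, neg_mul]
  ring

/-- On the critical strip the rotated integrand is, up to a constant, a product of two Mellin
transforms. The factor `e^{-πis/2}` is shared equally between them: the exponential has scaling
`2πx e^{iπ/4}` and the power of `1 + ct` has `c = e^{-iπ/4}`, both in the open right half-plane. -/
theorem mellin_mul_mellin_eq_rotatedIntegrand {n : ℕ} {x : ℝ} (hx : 0 < x) {s : ℂ}
    (hs : 0 < s.re) (hsn : s.re < n) :
    mellin (fun t : ℝ => Complex.exp
        (-(((2 * Real.pi * x : ℝ) : ℂ) * Complex.exp ((Real.pi / 4 : ℝ) * Complex.I)) * t)) s *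
      mellin (fun t : ℝ => (1 + Complex.exp ((-(Real.pi / 4) : ℝ) * Complex.I) * t) ^
        (-((n : ℂ) + 1))) (n - s) =
    Complex.exp (Real.pi / 4 * n * Complex.I) / n.factorial * rotatedIntegrand n x s := by
  have hX : (0 : ℝ) < 2 * Real.pi * x := by positivity
  have hpi := Real.pi_pos
  have hcos : 0 < Real.cos (Real.pi / 4) := by rw [Real.cos_pi_div_four]; positivity
  rw [mellin_exp_neg_mul hs (by
      rw [Complex.re_ofReal_mul, Complex.exp_ofReal_mul_I_re]; positivity),
    mellin_one_add_mul_cpow_neg (by rwa [Complex.exp_ofReal_mul_I_re, Real.cos_neg])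
      (by simpa using hsn) (by simp; linarith),
    ofReal_mul_cpow hX, exp_ofReal_mul_I_cpow (by linarith) (by linarith),
    exp_ofReal_mul_I_cpow (by linarith) (by linarith), Complex.Gamma_nat_eq_factorial,
    show (n : ℂ) + 1 - (n - s) = s + 1 by ring, rotatedIntegrand]
  have hexp : Complex.exp (((Real.pi / 4 : ℝ) : ℂ) * Complex.I * -s) *
      Complex.exp (((-(Real.pi / 4) : ℝ) : ℂ) * Complex.I * -(n - s)) =
      Complex.exp (Real.pi / 4 * n * Complex.I) *
        Complex.exp (-(Real.pi * s / 2 * Complex.I)) := by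
    rw [← Complex.exp_add, ← Complex.exp_add]
    congr 1
    push_cast
    ring
  linear_combination ((2 * Real.pi * x : ℝ) : ℂ) ^ (-s) * (Complex.Gamma s *
    Complex.Gamma (s + 1) * Complex.Gamma (n - s)) / n.factorial * hexp

/-- `2πix` has argument `π / 2`, so the contour in `hyperU` is the ray of argument `-π / 4`. -/
theorem hyperU_two_pi_I_mul {n : ℕ} (hn : 1 ≤ n) {x : ℝ} (hx : 0 < x) :
    hyperU n 0 (2 * Real.pi * Complex.I * x) =
      1 / (n - 1).factorial * (Complex.exp (-(Real.pi / 4 * n * Complex.I)) *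
        ∫ t in Ioi (0 : ℝ), (t : ℂ) ^ ((n : ℂ) - 1) * (Complex.exp
          (-(((2 * Real.pi * x : ℝ) : ℂ) * Complex.exp ((Real.pi / 4 : ℝ) * Complex.I)) * t) *
        (1 + Complex.exp ((-(Real.pi / 4) : ℝ) * Complex.I) * t) ^ (-((n : ℂ) + 1)))) := by
  have hpi := Real.pi_pos
  have hX : (0 : ℝ) < 2 * Real.pi * x := by positivity
  have hz : 2 * Real.pi * Complex.I * x = ((2 * Real.pi * x : ℝ) : ℂ) * Complex.I := by
    push_cast; ring
  have harg : Complex.arg (((2 * Real.pi * x : ℝ) : ℂ) * Complex.I) = Real.pi / 2 := by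
    rw [Complex.arg_real_mul _ hX, Complex.arg_I]
  have hGamma : Complex.Gamma n = (n - 1).factorial := by
    rw [← Complex.Gamma_nat_eq_factorial, Nat.cast_sub hn, Nat.cast_one, sub_add_cancel]
  have hI : Complex.exp ((Real.pi / 4 : ℝ) * Complex.I) =
      Complex.I * Complex.exp ((-(Real.pi / 4) : ℝ) * Complex.I) := by
    nth_rewrite 2 [← Complex.exp_pi_div_two_mul_I]
    rw [← Complex.exp_add]
    congr 1
    push_cast
    ring
  rw [hyperU, if_neg (by rw [hz]; simp), hz, harg, hyperURay, hGamma,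
    show -(Real.pi / 2) / 2 = -(Real.pi / 4) by ring,
    ← integral_const_mul (Complex.exp _)]
  congr 1
  refine setIntegral_congr_fun measurableSet_Ioi fun t ht => ?_
  have hc : Complex.exp ((-(Real.pi / 4) : ℝ) * Complex.I) ^ ((n : ℂ) - 1) *
      Complex.exp ((-(Real.pi / 4) : ℝ) * Complex.I) =
      Complex.exp (-(Real.pi / 4 * n * Complex.I)) := by
    rw [exp_ofReal_mul_I_cpow (by linarith) (by linarith), ← Complex.exp_add]
    congr 1
    push_cast
    ring
  rw [ofReal_mul_cpow (mem_Ioi.1 ht), ← hc, hI, zero_sub, ← neg_add',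
    mul_comm (t : ℂ) (Complex.exp _)]
  ring_nf

theorem integral_rotatedIntegrand {n : ℕ} {σ : ℝ} (hσ : 0 < σ) (hσn : σ < n) {x : ℝ}
    (hx : 0 < x) :
    Complex.VerticalIntegrable (rotatedIntegrand n x) σ ∧
      ∫ y : ℝ, rotatedIntegrand n x (σ + y * Complex.I) =
        2 * Real.pi * ((n - 1).factorial * n.factorial *
          hyperU n 0 (2 * Real.pi * Complex.I * x)) := by
  have hn : 1 ≤ n := by
    have : (0 : ℝ) < n := hσ.trans hσn
    exact_mod_cast this
  have hcos : 0 < Real.cos (Real.pi / 4) := by rw [Real.cos_pi_div_four]; positivity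
  have ha : 0 < (((2 * Real.pi * x : ℝ) : ℂ) *
      Complex.exp ((Real.pi / 4 : ℝ) * Complex.I)).re := by
    rw [Complex.re_ofReal_mul, Complex.exp_ofReal_mul_I_re]; positivity
  have hc : 0 < (Complex.exp ((-(Real.pi / 4) : ℝ) * Complex.I)).re := by
    rwa [Complex.exp_ofReal_mul_I_re, Real.cos_neg]
  obtain ⟨hint, heq⟩ := mellin_parseval (ν := n) (σ := σ)
    (mellinConvergent_exp_neg_mul (by simpa using hσ) ha)
    (verticalIntegrable_mellin_exp_neg_mul hσ ha) (by fun_prop)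
    (mellinConvergent_one_add_mul_cpow_neg (b := n + 1) (s := n - σ) hc (by simpa using hσn)
      (by simp; linarith))
  have hprod : ∀ y : ℝ, _ := fun y : ℝ =>
    mellin_mul_mellin_eq_rotatedIntegrand (n := n) hx (s := σ + y * Complex.I)
      (by simpa using hσ) (by simpa using hσn)
  have hfac : (n.factorial : ℂ) ≠ 0 := Nat.cast_ne_zero.2 n.factorial_ne_zero
  have hfac' : ((n - 1).factorial : ℂ) ≠ 0 := Nat.cast_ne_zero.2 (n - 1).factorial_ne_zero
  have hK : Complex.exp (Real.pi / 4 * n * Complex.I) / n.factorial ≠ 0 :=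
    div_ne_zero (Complex.exp_ne_zero _) hfac
  unfold Complex.VerticalIntegrable at hint ⊢
  simp_rw [hprod] at hint heq
  refine ⟨(integrable_const_mul_iff hK.isUnit _).1 hint, ?_⟩
  rw [integral_const_mul] at heq
  refine mul_left_cancel₀ hK (heq.trans ?_)
  rw [hyperU_two_pi_I_mul hn hx, Complex.exp_neg]
  generalize Complex.exp (Real.pi / 4 * n * Complex.I) = e at hK ⊢
  have he : e ≠ 0 := (div_ne_zero_iff.1 hK).1
  have hcancel : ∀ J : ℂ, 2 * Real.pi * J = e / n.factorial * (2 * Real.pi *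
      ((n - 1).factorial * n.factorial * (1 / (n - 1).factorial * (e⁻¹ * J)))) := fun J => by
    field_simp
  exact hcancel _

end CotangentSum

end

theorem corollary4p2 (n : ℕ) (hn : 2 ≤ n) (x : ℝ) (hx : 0 < x) :
    Complex.VerticalIntegrable (CotangentSum.barnesIntegrand n x) (3 / 2) ∧
      CotangentSum.barnesIntegral n x =
        (((n - 1).factorial * n.factorial *
          (CotangentSum.hyperU n 0 (2 * Real.pi * Complex.I * x)).re : ℝ) : ℂ) := by
  have hn' : (3 / 2 : ℝ) < n := by
    have : (2 : ℝ) ≤ n := by exact_mod_cast hn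
    linarith
  obtain ⟨hint, heq⟩ := CotangentSum.integral_rotatedIntegrand (σ := 3 / 2) (by norm_num) hn' hx
  have hB : ∀ y : ℝ, CotangentSum.barnesIntegrand n x (((3 / 2 : ℝ) : ℂ) + y * Complex.I) =
      (CotangentSum.rotatedIntegrand n x (((3 / 2 : ℝ) : ℂ) + y * Complex.I) +
        starRingEnd ℂ (CotangentSum.rotatedIntegrand n x
          (((3 / 2 : ℝ) : ℂ) + (-y : ℝ) * Complex.I))) / 2 := by
    intro y
    rw [CotangentSum.barnesIntegrand_eq hx, map_add, map_mul, Complex.conj_ofReal,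
      Complex.conj_ofReal, Complex.conj_I, Complex.ofReal_neg, neg_mul, mul_neg]
  have hint' : Integrable fun y : ℝ => starRingEnd ℂ (CotangentSum.rotatedIntegrand n x
      (((3 / 2 : ℝ) : ℂ) + (-y : ℝ) * Complex.I)) :=
    (Complex.conjLIE.integrable_comp_iff
      (φ := fun y : ℝ => CotangentSum.rotatedIntegrand n x
        (((3 / 2 : ℝ) : ℂ) + (-y : ℝ) * Complex.I))).2 hint.comp_neg
  refine ⟨?_, ?_⟩
  · unfold Complex.VerticalIntegrable
    simp_rw [hB]
    exact (hint.add hint').div_const 2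
  · have hconj : ∫ y : ℝ, starRingEnd ℂ (CotangentSum.rotatedIntegrand n x
        (((3 / 2 : ℝ) : ℂ) + (-y : ℝ) * Complex.I)) =
        starRingEnd ℂ (∫ y : ℝ, CotangentSum.rotatedIntegrand n x
          (((3 / 2 : ℝ) : ℂ) + y * Complex.I)) := by
      rw [integral_neg_eq_self (fun y : ℝ => starRingEnd ℂ (CotangentSum.rotatedIntegrand n x
        (((3 / 2 : ℝ) : ℂ) + y * Complex.I))), integral_conj]
    have hpi : (Real.pi : ℂ) ≠ 0 := Complex.ofReal_ne_zero.2 Real.pi_ne_zero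
    unfold CotangentSum.barnesIntegral
    simp_rw [hB]
    rw [integral_mul_const, integral_div, integral_add hint hint', hconj, Complex.add_conj, heq,
      show 2 * (Real.pi : ℂ) * ((n - 1).factorial * n.factorial *
          CotangentSum.hyperU n 0 (2 * Real.pi * Complex.I * x)) =
        ((2 * Real.pi * ((n - 1).factorial * n.factorial) : ℝ) : ℂ) *
          CotangentSum.hyperU n 0 (2 * Real.pi * Complex.I * x) by push_cast; ring,
      Complex.re_ofReal_mul]
    push_cast
    field_simp
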